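/- Let $L\subset\mathbb{C}$ be a lattice (of rank $2$) and let $N$ be a positive integer. An \emph{elliptic function of level $N$ with lattice $L$} is a meromorphic function $f$ on $\mathbb{C}$ with $f(0)=0$, $f'(0)=1$, such that $f(z)^N$ is an elliptic function with lattice $L$ whose divisor on $\mathbb{C}/L$ is $N\cdot 0-N\cdot\rho$ for some $\rho\in\mathbb{C}$, and such that $N$ is the smallest positive integer with this property (for $f$ and $L$). \textbf{Theorem.} Let $f$ be an elliptic function of level $N$ with lattice $L$, and let $n>1$ be an integer with $N\mid n$. Then $f$ is a solution of the Hirzebruch functional equation $$\sum_{i=1}^{n}\ \prod_{j\neq i}\frac{1}{f(z_j-z_i)}=c$$ with $c=0$; that is, the identity holds with $c=0$ for all $(z_1,\dots,z_n)\in\mathbb{C}^n$ at which the left-hand side is defined, i.e. such that for all $i\ne j$ the point $z_j-z_i$ is not a zero of $f$ (at a pole of $f$ the function $1/f$ has the value $0$). -/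

import Mathlib

/-- `g` is an elliptic function with lattice `L`: a meromorphic function on `ℂ` having every element
of `L` as a period. Here, as below, a meromorphic function on `ℂ` is represented by its normal form
(`MeromorphicNFOn`): it is analytic wherever it has no pole, and at a pole the Lean function takes
the value `0` by convention. -/
def IsEllipticWith (L : PeriodPair) (g : ℂ → ℂ) : Prop :=
  MeromorphicNFOn g Set.univ ∧ ∀ l ∈ L.lattice, ∀ z, g (z + l) = g z

open Classical in
/-- The divisor on `ℂ / L` of the (`L`-periodic) function `g` is `N · 0 - N · ρ`. -/
def HasDivisorZeroSub (L : PeriodPair) (N : ℕ) (ρ : ℂ) (g : ℂ → ℂ) : Prop :=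
  ∀ z : ℂ, meromorphicOrderAt g z =
    (((if z ∈ L.lattice then (N : ℤ) else 0) - (if z - ρ ∈ L.lattice then (N : ℤ) else 0) : ℤ) :
      WithTop ℤ)

/-- `f ^ N` is elliptic with lattice `L` and divisor `N · 0 - N · ρ` for some `ρ`. -/
def HasLevelProperty (L : PeriodPair) (f : ℂ → ℂ) (N : ℕ) : Prop :=
  IsEllipticWith L (fun z ↦ f z ^ N) ∧ ∃ ρ : ℂ, HasDivisorZeroSub L N ρ (fun z ↦ f z ^ N)

/-- `f` is an elliptic function of level `N` with lattice `L`. -/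
structure IsEllipticOfLevel (L : PeriodPair) (N : ℕ) (f : ℂ → ℂ) : Prop where
  meromorphic : MeromorphicNFOn f Set.univ
  map_zero : f 0 = 0
  hasDerivAt_zero : HasDerivAt f 1 0
  isLeast : IsLeast {M : ℕ | 0 < M ∧ HasLevelProperty L f M} N

/-- `f` is a meromorphic solution, with `f 0 = 0` and `f' 0 = 1`, of the Hirzebruch functional
equation in `n` variables with constant `c`. The left-hand side is defined at `z` when no
`z j - z i` with `i ≠ j` is a pole of `1 / f`, that is, when `f` has order at most `0` at each of
them. At a pole of `f` the meromorphic function `1 / f` has the value `0`, which is also the value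
of `1 / f` in Lean for `f` in normal form. -/
structure IsHirzebruchSolution (n : ℕ) (c : ℂ) (f : ℂ → ℂ) : Prop where
  meromorphic : MeromorphicNFOn f Set.univ
  map_zero : f 0 = 0
  hasDerivAt_zero : HasDerivAt f 1 0
  equation : ∀ z : Fin n → ℂ, (∀ i j, i ≠ j → meromorphicOrderAt f (z j - z i) ≤ 0) →
    ∑ i, ∏ j ∈ Finset.univ.erase i, 1 / f (z j - z i) = c

/-!
Put `g = 1 / f`. Since `f ^ N` is elliptic, `f (z + l) / f z` is for each lattice point `l` a
continuous function, off a countable set, with values in the `N`-th roots of unity, hence constant.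
So `g (z + l) = χ l * g z` with `χ l ^ N = 1`, and the divisor of `f ^ N` shows that the only poles
of `g` are simple ones at the lattice points (`exists_hasMultiplierAndSimplePoles`).

Fix all the variables but one, `w`. At `w = z_k` the simple poles of two summands of the left-hand
side cancel (`tendsto_sub_mul_hirzebruchSum`), so it extends to an entire function of `w`. Under
`w ↦ w + l` it is multiplied by `χ l`: for the summands with one factor depending on `w` this is
clear, and the remaining one is multiplied by `χ (-l) ^ (n - 1) = χ l` because `N ∣ n`
(`hirzebruchSum_add`). As its absolute value is invariant under translation by the lattice, the entire
function is bounded, hence constant by Liouville's theorem, and the constant is `0` as soon as some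
`χ l ≠ 1`.

Such an `l` exists, since otherwise `g` would be an elliptic function with a single simple pole
(`exists_multiplier_ne_one`). This is excluded without residues: for a suitable constant `a` the
periodic function `g' + g ^ 2 - a g` has no poles, so it is constant. Thus
`g' = -(g - α) (g - β)`, and `g` never takes the constant solution `α` as a value; then
`1 / (g - α)` is entire and periodic, hence constant, which is absurd.
-/

open Filter Topology

/-! ### Liouville's theorem with multipliers -/

/-- A meromorphic function all of whose poles are removable extends to an entire function. -/
lemma exists_differentiable_eventuallyEq_nhdsNE {H : ℂ → ℂ} (hH : MeromorphicOn H Set.univ)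
    (hord : ∀ z, 0 ≤ meromorphicOrderAt H z) :
    ∃ E : ℂ → ℂ, Differentiable ℂ E ∧ ∀ z, H =ᶠ[𝓝[≠] z] E := by
  refine ⟨toMeromorphicNFOn H Set.univ, fun z ↦ ?_, fun z ↦
    (hH.toMeromorphicNFOn_eq_self_on_nhdsNE (Set.mem_univ z)).symm⟩
  have hnf := meromorphicNFOn_toMeromorphicNFOn H Set.univ (Set.mem_univ z)
  exact (hnf.meromorphicOrderAt_nonneg_iff_analyticAt.1 (by
    rw [meromorphicOrderAt_toMeromorphicNFOn hH (Set.mem_univ z)]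
    exact hord z)).differentiableAt

/-- An entire function whose values are multiplied by numbers of absolute value `1` under
translation by a lattice is constant. -/
lemma PeriodPair.exists_eq_const_of_map_add (L : PeriodPair) {E : ℂ → ℂ} (hE : Differentiable ℂ E)
    (hq : ∀ l ∈ L.lattice, ∃ c : ℂ, ‖c‖ = 1 ∧ ∀ z, E (z + l) = c * E z) :
    ∃ b, ∀ z, E z = b := by
  obtain ⟨C, hC⟩ := (ProperSpace.isCompact_closedBall (0 : ℂ) (∑ i, ‖L.basis i‖)
    ).exists_bound_of_continuousOn hE.continuous.continuousOn
  refine hE.exists_const_forall_eq_of_bounded (isBounded_iff_forall_norm_le.2 ⟨C, ?_⟩)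
  rintro _ ⟨z, rfl⟩
  obtain ⟨c, hc, h⟩ := hq (ZSpan.floor L.basis z : ℂ) (by
    rw [L.lattice_eq_span_range_basis]
    exact (ZSpan.floor L.basis z).2)
  have hz := h (ZSpan.fract L.basis z)
  rw [ZSpan.fract_apply, sub_add_cancel, ← ZSpan.fract_apply] at hz
  rw [hz, norm_mul, hc, one_mul]
  exact hC _ (by simpa using ZSpan.norm_fract_le L.basis z)

/-- **Liouville's theorem for multiplicative quasi-periods.** If translation by each lattice point
multiplies a meromorphic function by a constant of absolute value `1`, and every point has a
lattice translate at which the function has no genuine pole, then the function is constant up to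
its values at isolated points. -/
lemma PeriodPair.exists_eventuallyEq_const (L : PeriodPair) {H : ℂ → ℂ}
    (hH : MeromorphicOn H Set.univ)
    (hq : ∀ l ∈ L.lattice, ∃ c : ℂ, ‖c‖ = 1 ∧ ∀ z, H (z + l) = c * H z)
    (hord : ∀ z, ∃ l ∈ L.lattice, 0 ≤ meromorphicOrderAt H (z + l)) :
    ∃ b, ∀ z, H =ᶠ[𝓝[≠] z] fun _ ↦ b := by
  have hord' (z : ℂ) : 0 ≤ meromorphicOrderAt H z := by
    obtain ⟨l, hl, h⟩ := hord z
    obtain ⟨c, hc, hcH⟩ := hq l hl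
    rw [← meromorphicOrderAt_comp_add_const_eq_meromorphicOrderAt,
      show H ∘ (· + l) = (fun _ ↦ c) * H from funext hcH,
      meromorphicOrderAt_mul_of_ne_zero analyticAt_const (by rintro rfl; simp at hc)] at h
    exact h
  obtain ⟨E, hE, hHE⟩ := exists_differentiable_eventuallyEq_nhdsNE hH hord'
  obtain ⟨b, hb⟩ := L.exists_eq_const_of_map_add hE fun l hl ↦ by
    obtain ⟨c, hc, hcH⟩ := hq l hl
    refine ⟨c, hc, fun z ↦ ?_⟩
    have ht : Tendsto (fun w : ℂ ↦ w + l) (𝓝[≠] z) (𝓝[≠] (z + l)) :=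
      ((continuous_add_const l).tendsto z).inf (by
        simp only [tendsto_principal_principal]
        intro a ha
        simpa using ha)
    have h1 : (fun w ↦ E (w + l)) =ᶠ[𝓝[≠] z] fun w ↦ c * E w := by
      filter_upwards [hHE z, ht.eventually (hHE (z + l))] with w hw hw'
      rw [← hw, ← hw', hcH]
    exact ((ContinuousAt.eventuallyEq_nhds_iff_eventuallyEq_nhdsNE
      (hE.continuous.comp (continuous_add_const l)).continuousAt
      (hE.continuous.const_mul c).continuousAt).1 h1).eq_of_nhds
  exact ⟨b, fun z ↦ (hHE z).trans (.of_forall hb)⟩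

lemma ContinuousAt.eq_of_eventuallyEq_const_nhdsNE {H : ℂ → ℂ} {z b : ℂ} (hc : ContinuousAt H z)
    (h : H =ᶠ[𝓝[≠] z] fun _ ↦ b) : H z = b :=
  ((hc.eventuallyEq_nhds_iff_eventuallyEq_nhdsNE continuousAt_const).1 h).eq_of_nhds

/-- A product `(z - a) H z` tending to `0` at `a` rules out a pole of `H` at `a`. -/
lemma MeromorphicAt.meromorphicOrderAt_nonneg_of_tendsto_sub_mul {H : ℂ → ℂ} {a : ℂ}
    (hH : MeromorphicAt H a) (h : Tendsto (fun z ↦ (z - a) * H z) (𝓝[≠] a) (𝓝 0)) :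
    0 ≤ meromorphicOrderAt H a := by
  have hid : MeromorphicAt (fun z : ℂ ↦ z - a) a := by fun_prop
  have h1 : 0 < meromorphicOrderAt ((fun z : ℂ ↦ z - a) * H) a :=
    (tendsto_zero_iff_meromorphicOrderAt_pos (hid.mul hH)).1 h
  have h2 : meromorphicOrderAt (fun z : ℂ ↦ z - a) a = ((1 : ℤ) : WithTop ℤ) :=
    meromorphicOrderAt_id_sub_const
  rw [meromorphicOrderAt_mul hid hH, h2] at h1
  cases h3 : meromorphicOrderAt H a with
  | top => simp
  | coe n =>
    rw [h3] at h1
    norm_cast at h1 ⊢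
    omega

/-! ### Functions with a single simple pole modulo the lattice -/

/-- `g` is a meromorphic function with multiplier `χ l` under translation by each `l` in `L`, whose
only poles are simple ones at the points of `L`, with principal part `1 / z` at `0`. The values at
the poles are only constrained by the behaviour under translation. -/
structure PeriodPair.HasMultiplierAndSimplePoles (L : PeriodPair) (χ : ℂ → ℂ) (g : ℂ → ℂ) :
    Prop where
  meromorphicOn : MeromorphicOn g Set.univ
  analyticAt : ∀ z ∉ L.lattice, AnalyticAt ℂ g z
  map_add : ∀ l ∈ L.lattice, ∀ z, g (z + l) = χ l * g z
  tendsto_mul : Tendsto (fun z ↦ z * g z) (𝓝[≠] 0) (𝓝 1)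

lemma PeriodPair.eventually_notMem_lattice (L : PeriodPair) :
    ∀ᶠ z in 𝓝[≠] (0 : ℂ), z ∉ L.lattice := by
  rw [eventually_nhdsWithin_iff]
  filter_upwards [L.compl_lattice_sdiff_singleton_mem_nhds 0] with z hz hz0 hzL
  exact hz ⟨hzL, hz0⟩

lemma Complex.isConnected_compl_of_countable {S : Set ℂ} (hS : S.Countable) :
    IsConnected Sᶜ :=
  hS.isConnected_compl_of_one_lt_rank (by simp [Complex.rank_real_complex])

lemma PeriodPair.countable_lattice (L : PeriodPair) : (L.lattice : Set ℂ).Countable := by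
  have : Countable L.lattice := L.latticeEquivProd.toEquiv.countable_iff.2 inferInstance
  exact this

/-- Multiplying by `z` removes the pole at `0`. -/
lemma PeriodPair.HasMultiplierAndSimplePoles.exists_analyticAt {L : PeriodPair} {χ g : ℂ → ℂ}
    (hg : L.HasMultiplierAndSimplePoles χ g) :
    ∃ k : ℂ → ℂ, AnalyticAt ℂ k 0 ∧ k 0 = 1 ∧ ∀ z ≠ 0, g z = k z / z := by
  have hev : (fun z ↦ z * g z) =ᶠ[𝓝[≠] 0] Function.update (fun z ↦ z * g z) 0 1 := by
    filter_upwards [self_mem_nhdsWithin] with z hz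
    rw [Function.update_of_ne hz]
  have hm : MeromorphicAt (fun z ↦ z * g z) 0 :=
    (MeromorphicAt.id 0).mul (hg.meromorphicOn 0 (Set.mem_univ 0))
  refine ⟨Function.update (fun z ↦ z * g z) 0 1, (hm.congr hev).analyticAt
    (continuousAt_update_same.2 hg.tendsto_mul), by simp, fun z hz ↦ ?_⟩
  rw [Function.update_of_ne hz, mul_div_cancel_left₀ _ hz]

/-- With `a` twice the constant term of `g` at `0`, the double poles of `g'` and `g ^ 2` and the
remaining simple pole cancel in `g' + g ^ 2 - a g`. -/
lemma PeriodPair.HasMultiplierAndSimplePoles.exists_tendsto_riccati {L : PeriodPair}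
    {χ g : ℂ → ℂ} (hg : L.HasMultiplierAndSimplePoles χ g) :
    ∃ a : ℂ, Tendsto (fun z ↦ (z - 0) * (deriv g z + g z ^ 2 - a * g z)) (𝓝[≠] 0) (𝓝 0) := by
  obtain ⟨k, hk, hk0, hgk⟩ := hg.exists_analyticAt
  refine ⟨2 * deriv k 0, ?_⟩
  have hev : (fun z ↦ deriv k z + k z * dslope k 0 z - 2 * deriv k 0 * k z) =ᶠ[𝓝[≠] 0]
      fun z ↦ (z - 0) * (deriv g z + g z ^ 2 - 2 * deriv k 0 * g z) := by
    filter_upwards [self_mem_nhdsWithin,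
      hk.eventually_analyticAt.filter_mono nhdsWithin_le_nhds] with z hz hkz
    have hz : z ≠ 0 := hz
    have hd : HasDerivAt (fun w ↦ k w / w) ((deriv k z * z - k z * 1) / z ^ 2) z :=
      hkz.differentiableAt.hasDerivAt.div (hasDerivAt_id z) hz
    have hgd : deriv g z = (deriv k z * z - k z * 1) / z ^ 2 :=
      (hd.congr_of_eventuallyEq (mem_of_superset (isOpen_ne.mem_nhds hz) hgk)).deriv
    rw [hgd, hgk z hz, dslope_of_ne _ hz, slope_def_field, hk0]
    field_simp
    ring
  refine Tendsto.congr' hev ?_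
  have hds : ContinuousAt (dslope k 0) 0 := continuousAt_dslope_same.2 hk.differentiableAt
  have hc : ContinuousAt
      (fun z ↦ deriv k z + k z * dslope k 0 z - 2 * deriv k 0 * k z) 0 :=
    (hk.deriv.continuousAt.add (hk.continuousAt.mul hds)).sub
      (continuousAt_const.mul hk.continuousAt)
  have ht := hc.tendsto.mono_left (nhdsWithin_le_nhds (s := {0}ᶜ))
  rw [hk0, dslope_same] at ht
  convert ht using 2
  ring

/-- If an analytic function satisfies the linear equation `d' = d m` and vanishes at a point, it
vanishes near that point. -/
lemma AnalyticAt.eventually_eq_zero_of_deriv_eq_mul {d m : ℂ → ℂ} {z₀ : ℂ}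
    (hd : AnalyticAt ℂ d z₀) (hm : AnalyticAt ℂ m z₀) (h : deriv d =ᶠ[𝓝 z₀] d * m)
    (h0 : d z₀ = 0) : ∀ᶠ z in 𝓝 z₀, d z = 0 := by
  rw [← analyticOrderAt_eq_top]
  by_contra htop
  have h1 := hd.analyticOrderAt_deriv_add_one
  simp only [h0, sub_zero] at h1
  rw [analyticOrderAt_congr h, analyticOrderAt_mul hd hm] at h1
  obtain ⟨p, hp⟩ := ENat.ne_top_iff_exists.1 htop
  rw [← hp] at h1
  cases hq : analyticOrderAt m z₀ with
  | top => simp [hq] at h1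
  | coe q =>
    rw [hq] at h1
    norm_cast at h1
    omega

/-- There is no function on `ℂ / L` with a single simple pole. Such a `g` satisfies a Riccati
equation `g' = -(g - α) (g - β)` with constant coefficients; by uniqueness of solutions it omits the
value `α`, so `1 / (g - α)` is entire and periodic, hence constant. -/
theorem PeriodPair.HasMultiplierAndSimplePoles.exists_multiplier_ne_one {L : PeriodPair}
    {χ g : ℂ → ℂ} (hg : L.HasMultiplierAndSimplePoles χ g) : ∃ l ∈ L.lattice, χ l ≠ 1 := by
  by_contra! hχ
  have hper : ∀ l ∈ L.lattice, ∀ z, g (z + l) = g z := fun l hl z ↦ by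
    rw [hg.map_add l hl, hχ l hl, one_mul]
  have hopen : IsOpen ((L.lattice : Set ℂ)ᶜ) := L.isClosed_lattice.isOpen_compl
  have hgm (z : ℂ) : MeromorphicAt g z := hg.meromorphicOn z (Set.mem_univ z)
  -- Every point is either off the lattice or a lattice translate of `0`.
  have hord {H : ℂ → ℂ} (h1 : ∀ z ∉ L.lattice, AnalyticAt ℂ H z)
      (h2 : 0 ≤ meromorphicOrderAt H 0) (z : ℂ) :
      ∃ l ∈ L.lattice, 0 ≤ meromorphicOrderAt H (z + l) := by
    by_cases hz : z ∈ L.lattice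
    · exact ⟨-z, neg_mem hz, by simpa using h2⟩
    · exact ⟨0, zero_mem _, by simpa using (h1 z hz).meromorphicOrderAt_nonneg⟩
  obtain ⟨a, ha⟩ := hg.exists_tendsto_riccati
  have hHan (z : ℂ) (hz : z ∉ L.lattice) :
      AnalyticAt ℂ (fun z ↦ deriv g z + g z ^ 2 - a * g z) z := by
    have := hg.analyticAt z hz
    have := this.deriv
    fun_prop
  have hHm (z : ℂ) : MeromorphicAt (fun z ↦ deriv g z + g z ^ 2 - a * g z) z :=
    ((hgm z).deriv.add ((hgm z).pow 2)).sub ((MeromorphicAt.const a z).mul (hgm z))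
  obtain ⟨b, hb⟩ := L.exists_eventuallyEq_const (fun z _ ↦ hHm z)
    (fun l hl ↦ ⟨1, by simp, fun z ↦ by
      rw [← deriv_comp_add_const, funext (hper l hl), hper l hl, one_mul]⟩)
    (hord hHan ((hHm 0).meromorphicOrderAt_nonneg_of_tendsto_sub_mul ha))
  obtain ⟨s, hs⟩ := IsAlgClosed.exists_pow_nat_eq (a ^ 2 + 4 * b) (n := 2) (by norm_num)
  obtain ⟨α, hα⟩ : ∃ α, α = (a + s) / 2 := ⟨_, rfl⟩
  have hric (z : ℂ) (hz : z ∉ L.lattice) :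
      deriv g z = (g z - α) * -(g z - (a - s) / 2) := by
    have := (hHan z hz).continuousAt.eq_of_eventuallyEq_const_nhdsNE (hb z)
    rw [hα]
    linear_combination this - hs / 4
  have hne (z : ℂ) (hz : z ∉ L.lattice) : g z - α ≠ 0 := by
    intro h0
    have hev : ∀ᶠ w in 𝓝 z, g w - α = 0 := by
      have hgz := hg.analyticAt z hz
      refine AnalyticAt.eventually_eq_zero_of_deriv_eq_mul (hgz.sub analyticAt_const)
        (m := fun w ↦ -(g w - (a - s) / 2)) (by fun_prop) ?_ h0
      filter_upwards [hopen.mem_nhds hz] with w hw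
      simpa using hric w hw
    have heq : Set.EqOn g (fun _ ↦ α) (L.lattice : Set ℂ)ᶜ :=
      AnalyticOnNhd.eqOn_of_preconnected_of_eventuallyEq (fun w hw ↦ hg.analyticAt w hw)
        (fun _ _ ↦ analyticAt_const)
        (Complex.isConnected_compl_of_countable L.countable_lattice).isPreconnected hz
        (hev.mono fun w hw ↦ sub_eq_zero.1 hw)
    have h1 : Tendsto (fun z : ℂ ↦ z * α) (𝓝[≠] 0) (𝓝 1) :=
      hg.tendsto_mul.congr' (L.eventually_notMem_lattice.mono fun w hw ↦ by rw [heq hw])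
    have h2 : Tendsto (fun z : ℂ ↦ z * α) (𝓝[≠] 0) (𝓝 (0 * α)) :=
      ((continuous_mul_const α).tendsto 0).mono_left nhdsWithin_le_nhds
    simpa using tendsto_nhds_unique h1 h2
  have hum (z : ℂ) : MeromorphicAt (fun z ↦ (g z - α)⁻¹) z :=
    ((hgm z).sub (MeromorphicAt.const α z)).inv
  have hu0 : Tendsto (fun z ↦ (g z - α)⁻¹) (𝓝[≠] 0) (𝓝 0) := by
    have h1 : Tendsto (fun z : ℂ ↦ z) (𝓝[≠] 0) (𝓝 0) := nhdsWithin_le_nhds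
    have h2 : Tendsto (fun z ↦ z / (z * g z - z * α)) (𝓝[≠] 0) (𝓝 (0 / (1 - 0 * α))) :=
      h1.div (hg.tendsto_mul.sub (h1.mul_const α)) (by simp)
    rw [zero_div] at h2
    refine h2.congr' ?_
    filter_upwards [self_mem_nhdsWithin, L.eventually_notMem_lattice] with z hz hzL
    have hz : z ≠ 0 := hz
    rw [← mul_sub, div_mul_eq_div_div, div_self hz, one_div]
  obtain ⟨c, hc⟩ := L.exists_eventuallyEq_const (fun z _ ↦ hum z)
    (fun l hl ↦ ⟨1, by simp, fun z ↦ by rw [hper l hl, one_mul]⟩)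
    (hord (fun z hz ↦ ((hg.analyticAt z hz).sub analyticAt_const).inv (hne z hz))
      ((tendsto_nhds_iff_meromorphicOrderAt_nonneg (hum 0)).1 ⟨0, hu0⟩))
  have hc0 : (0 : ℂ) = c := tendsto_nhds_unique hu0 (tendsto_const_nhds.congr' (hc 0).symm)
  obtain ⟨z, hz, hzL⟩ := ((hc 0).and L.eventually_notMem_lattice).exists
  exact inv_ne_zero (hne z hzL) (hz.trans hc0.symm)

/-! ### The Hirzebruch sum as a function of one variable -/

/-- The left-hand side of the Hirzebruch equation for `1 / f = g`, as a function of one variable `w`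
with the remaining variables `a i`, `i ∈ S`, fixed. -/
def hirzebruchSum {ι : Type*} [DecidableEq ι] (g : ℂ → ℂ) (S : Finset ι) (a : ι → ℂ) (w : ℂ) : ℂ :=
  ∏ j ∈ S, g (a j - w) + ∑ i ∈ S, g (w - a i) * ∏ j ∈ S.erase i, g (a j - a i)

lemma sum_prod_erase_eq_hirzebruchSum {ι : Type*} [Fintype ι] [DecidableEq ι] (g : ℂ → ℂ)
    (z : ι → ℂ) (k : ι) :
    ∑ i, ∏ j ∈ Finset.univ.erase i, g (z j - z i) =
      hirzebruchSum g (Finset.univ.erase k) z (z k) := by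
  rw [hirzebruchSum, ← Finset.add_sum_erase _ _ (Finset.mem_univ k)]
  congr 1
  refine Finset.sum_congr rfl fun i hi ↦ ?_
  have hki : k ∈ Finset.univ.erase i :=
    Finset.mem_erase.2 ⟨(Finset.ne_of_mem_erase hi).symm, Finset.mem_univ k⟩
  rw [← Finset.mul_prod_erase _ _ hki, Finset.erase_right_comm]

namespace PeriodPair.HasMultiplierAndSimplePoles

variable {L : PeriodPair} {χ g : ℂ → ℂ} {ι : Type*} [DecidableEq ι] {S : Finset ι} {a : ι → ℂ}

lemma multiplier_neg_mul (hg : L.HasMultiplierAndSimplePoles χ g) {l : ℂ} (hl : l ∈ L.lattice) :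
    χ (-l) * χ l = 1 := by
  have hne : ∀ᶠ z in 𝓝[≠] (0 : ℂ), z * g z ≠ 0 := hg.tendsto_mul.eventually_ne one_ne_zero
  obtain ⟨z, hz⟩ := hne.exists
  have h := hg.map_add (-l) (neg_mem hl) (z + l)
  rw [add_neg_cancel_right, hg.map_add l hl, ← mul_assoc] at h
  exact mul_right_cancel₀ (right_ne_zero_of_mul hz) (h.symm.trans (one_mul _).symm)

lemma meromorphicAt_hirzebruchSum (hg : L.HasMultiplierAndSimplePoles χ g) (w : ℂ) :
    MeromorphicAt (hirzebruchSum g S a) w := by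
  have h1 (c : ℂ) : MeromorphicAt (fun w ↦ g (w - c)) w :=
    (hg.meromorphicOn (w - c) (Set.mem_univ _)).comp_analyticAt (g := fun w ↦ w - c) (by fun_prop)
  have h2 (c : ℂ) : MeromorphicAt (fun w ↦ g (c - w)) w :=
    (hg.meromorphicOn (c - w) (Set.mem_univ _)).comp_analyticAt (g := fun w ↦ c - w) (by fun_prop)
  exact (MeromorphicAt.fun_prod fun j _ ↦ h2 (a j)).add
    (MeromorphicAt.fun_sum fun i _ ↦ (h1 (a i)).mul (MeromorphicAt.const _ w))

lemma analyticAt_sub (hg : L.HasMultiplierAndSimplePoles χ g) {w c : ℂ} (h : w - c ∉ L.lattice) :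
    AnalyticAt ℂ (fun w ↦ g (w - c)) w :=
  (hg.analyticAt _ h).fun_comp (f := fun w ↦ w - c) (by fun_prop)

lemma analyticAt_sub' (hg : L.HasMultiplierAndSimplePoles χ g) {w c : ℂ} (h : w - c ∉ L.lattice) :
    AnalyticAt ℂ (fun w ↦ g (c - w)) w :=
  (hg.analyticAt _ (fun h' ↦ h (by simpa using neg_mem h'))).fun_comp (f := fun w ↦ c - w)
    (by fun_prop)

lemma analyticAt_hirzebruchSum (hg : L.HasMultiplierAndSimplePoles χ g) {w : ℂ}
    (hw : ∀ j ∈ S, w - a j ∉ L.lattice) : AnalyticAt ℂ (hirzebruchSum g S a) w :=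
  (Finset.analyticAt_fun_prod S fun j hj ↦ hg.analyticAt_sub' (hw j hj)).add
    (Finset.analyticAt_fun_sum S fun i hi ↦ (hg.analyticAt_sub (hw i hi)).mul analyticAt_const)

/-- The simple poles at `w = a k` of the product and of the `k`-th summand cancel, and no other
summand has a pole there. -/
lemma tendsto_sub_mul_hirzebruchSum (hg : L.HasMultiplierAndSimplePoles χ g)
    (ha : ∀ i ∈ S, ∀ j ∈ S, i ≠ j → a j - a i ∉ L.lattice) {k : ι} (hk : k ∈ S) :
    Tendsto (fun w ↦ (w - a k) * hirzebruchSum g S a w) (𝓝[≠] (a k)) (𝓝 0) := by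
  have hsub : Tendsto (fun w ↦ w - a k) (𝓝[≠] (a k)) (𝓝[≠] 0) := by
    refine tendsto_nhdsWithin_iff.2 ⟨?_, ?_⟩
    · have h : ContinuousAt (fun w ↦ w - a k) (a k) := by fun_prop
      simpa using h.tendsto.mono_left nhdsWithin_le_nhds
    · filter_upwards [self_mem_nhdsWithin] with w hw
      exact sub_ne_zero.2 hw
  have hneg : Tendsto (fun w ↦ a k - w) (𝓝[≠] (a k)) (𝓝[≠] 0) := by
    refine tendsto_nhdsWithin_iff.2 ⟨?_, ?_⟩
    · have h : ContinuousAt (fun w ↦ a k - w) (a k) := by fun_prop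
      simpa using h.tendsto.mono_left nhdsWithin_le_nhds
    · filter_upwards [self_mem_nhdsWithin] with w hw
      exact sub_ne_zero.2 (Ne.symm hw)
  have hres := hg.tendsto_mul.comp hsub
  have hres' := hg.tendsto_mul.comp hneg
  have hprod : Tendsto (fun w ↦ ∏ j ∈ S.erase k, g (a j - w)) (𝓝[≠] (a k))
      (𝓝 (∏ j ∈ S.erase k, g (a j - a k))) := by
    refine tendsto_finsetProd _ fun j hj ↦ ?_
    exact (hg.analyticAt_sub' (ha j (Finset.mem_of_mem_erase hj) k hk
      (Finset.ne_of_mem_erase hj))).continuousAt.tendsto.mono_left nhdsWithin_le_nhds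
  have hsum : Tendsto (fun w ↦ (w - a k) *
      ∑ i ∈ S.erase k, g (w - a i) * ∏ j ∈ S.erase i, g (a j - a i)) (𝓝[≠] (a k)) (𝓝 (0 *
      ∑ i ∈ S.erase k, g (a k - a i) * ∏ j ∈ S.erase i, g (a j - a i))) := by
    refine (hsub.mono_right nhdsWithin_le_nhds).mul (tendsto_finsetSum _ fun i hi ↦ ?_)
    exact ((hg.analyticAt_sub (ha i (Finset.mem_of_mem_erase hi) k hk
      (Finset.ne_of_mem_erase hi))).continuousAt.tendsto.mono_left nhdsWithin_le_nhds).mul_const _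
  have h := ((hres'.neg.mul hprod).add
    (hres.mul_const (∏ j ∈ S.erase k, g (a j - a k)))).add hsum
  have h0 : (0 : ℂ) = -1 * ∏ j ∈ S.erase k, g (a j - a k) +
      1 * ∏ j ∈ S.erase k, g (a j - a k) +
      0 * ∑ i ∈ S.erase k, g (a k - a i) * ∏ j ∈ S.erase i, g (a j - a i) := by ring
  rw [h0]
  refine h.congr fun w ↦ ?_
  simp only [hirzebruchSum, Function.comp_apply]
  rw [← Finset.mul_prod_erase S (fun j ↦ g (a j - w)) hk, ← Finset.add_sum_erase S
    (fun i ↦ g (w - a i) * ∏ j ∈ S.erase i, g (a j - a i)) hk]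
  ring

/-- When `χ` takes values in the roots of unity of order `#S + 1`, the product is multiplied under
translation by `χ (-l) ^ #S = χ l`, just as the other summands are. -/
lemma hirzebruchSum_add (hg : L.HasMultiplierAndSimplePoles χ g)
    (hχ : ∀ l ∈ L.lattice, χ l ^ (S.card + 1) = 1) {l : ℂ} (hl : l ∈ L.lattice) (w : ℂ) :
    hirzebruchSum g S a (w + l) = χ l * hirzebruchSum g S a w := by
  have hpow : χ (-l) ^ S.card = χ l := by
    have h := hg.multiplier_neg_mul hl
    refine mul_left_cancel₀ (left_ne_zero_of_mul_eq_one h) ?_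
    rw [h, ← pow_succ', hχ (-l) (neg_mem hl)]
  have h1 (j : ι) : g (a j - (w + l)) = χ (-l) * g (a j - w) := by
    rw [← hg.map_add (-l) (neg_mem hl)]
    congr 1
    ring
  have h2 (i : ι) : g (w + l - a i) = χ l * g (w - a i) := by
    rw [← hg.map_add l hl]
    congr 1
    ring
  simp only [hirzebruchSum, h1, h2, Finset.prod_mul_distrib, Finset.prod_const, hpow, mul_add,
    Finset.mul_sum, mul_assoc]

/-- As a function of one variable the Hirzebruch sum is entire with a nontrivial multiplier, so it
is a constant that has to vanish. -/
theorem hirzebruchSum_eq_zero (hg : L.HasMultiplierAndSimplePoles χ g)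
    (hχ : ∀ l ∈ L.lattice, χ l ^ (S.card + 1) = 1)
    (ha : ∀ i ∈ S, ∀ j ∈ S, i ≠ j → a j - a i ∉ L.lattice) {w : ℂ}
    (hw : ∀ j ∈ S, w - a j ∉ L.lattice) : hirzebruchSum g S a w = 0 := by
  obtain ⟨b, hb⟩ := L.exists_eventuallyEq_const (H := hirzebruchSum g S a)
    (fun z _ ↦ hg.meromorphicAt_hirzebruchSum z)
    (fun l hl ↦ ⟨χ l, Complex.norm_eq_one_of_pow_eq_one (hχ l hl) (Nat.succ_ne_zero _),
      hg.hirzebruchSum_add hχ hl⟩)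
    (fun z ↦ by
      by_cases hz : ∀ j ∈ S, z - a j ∉ L.lattice
      · exact ⟨0, zero_mem _, by
          simpa using (hg.analyticAt_hirzebruchSum hz).meromorphicOrderAt_nonneg⟩
      · push Not at hz
        obtain ⟨k, hk, hkL⟩ := hz
        refine ⟨a k - z, by simpa using neg_mem hkL, ?_⟩
        rw [add_sub_cancel]
        exact (hg.meromorphicAt_hirzebruchSum _).meromorphicOrderAt_nonneg_of_tendsto_sub_mul
          (hg.tendsto_sub_mul_hirzebruchSum ha hk))
  have hval {z : ℂ} (hz : ∀ j ∈ S, z - a j ∉ L.lattice) : hirzebruchSum g S a z = b :=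
    (hg.analyticAt_hirzebruchSum hz).continuousAt.eq_of_eventuallyEq_const_nhdsNE (hb z)
  obtain ⟨l, hl, hl1⟩ := hg.exists_multiplier_ne_one
  have hwl : hirzebruchSum g S a (w + l) = b := hval fun j hj h ↦ hw j hj (by
    have := sub_mem h hl
    rwa [show w + l - a j - l = w - a j by ring] at this)
  rw [hg.hirzebruchSum_add hχ hl, hval hw] at hwl
  rw [hval hw]
  by_contra hb0
  exact hl1 (mul_right_cancel₀ hb0 (hwl.trans (one_mul b).symm))

end PeriodPair.HasMultiplierAndSimplePoles

/-! ### Elliptic functions of level `N` -/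

namespace IsEllipticOfLevel

variable {L : PeriodPair} {N : ℕ} {f : ℂ → ℂ}

lemma pos (hf : IsEllipticOfLevel L N f) : 0 < N := hf.isLeast.1.1

lemma meromorphicAt (hf : IsEllipticOfLevel L N f) (z : ℂ) : MeromorphicAt f z :=
  (hf.meromorphic (Set.mem_univ z)).meromorphicAt

/-- The zeros and poles of `f` are simple, they lie over `0` and over some `ρ`, and `ρ` is not a
lattice point because `f` vanishes at `0`. -/
lemma exists_order (hf : IsEllipticOfLevel L N f) :
    ∃ ρ ∉ L.lattice, (∀ z ∈ L.lattice, meromorphicOrderAt f z = 1) ∧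
      (∀ z, z - ρ ∈ L.lattice → meromorphicOrderAt f z = -1) ∧
      ∀ z ∉ L.lattice, z - ρ ∉ L.lattice → meromorphicOrderAt f z = 0 := by
  classical
  obtain ⟨ρ, hρ⟩ := hf.isLeast.1.2.2
  have hN := hf.pos
  have hord (z : ℂ) (n : ℤ)
      (h : (N : ℤ) * n = (if z ∈ L.lattice then (N : ℤ) else 0) -
        (if z - ρ ∈ L.lattice then (N : ℤ) else 0)) : meromorphicOrderAt f z = n := by
    have h1 := hρ z
    rw [show (fun z ↦ f z ^ N) = f ^ N from rfl, meromorphicOrderAt_pow (hf.meromorphicAt z)] at h1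
    cases h2 : meromorphicOrderAt f z with
    | top =>
      rw [h2, WithTop.mul_top (by exact_mod_cast hN.ne')] at h1
      exact absurd h1 (WithTop.top_ne_coe)
    | coe m =>
      rw [h2] at h1
      have h3 : (N : ℤ) * m = N * n := by
        rw [h]
        exact_mod_cast h1
      rw [mul_left_cancel₀ (by exact_mod_cast hN.ne') h3]
  have hρL : ρ ∉ L.lattice := by
    intro hmem
    have h0 : meromorphicOrderAt f 0 = (0 : ℤ) := hord 0 0 (by simp [hmem])
    have ht := hf.hasDerivAt_zero.continuousAt.tendsto.mono_left
      (nhdsWithin_le_nhds (s := {0}ᶜ))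
    rw [hf.map_zero] at ht
    have hpos := (tendsto_zero_iff_meromorphicOrderAt_pos (hf.meromorphicAt 0)).1 ht
    rw [h0] at hpos
    exact lt_irrefl _ hpos
  have hdisj {z : ℂ} (hz : z ∈ L.lattice) : z - ρ ∉ L.lattice := fun hz' ↦
    hρL (by simpa using sub_mem hz hz')
  refine ⟨ρ, hρL, fun z hz ↦ ?_, fun z hz ↦ ?_, fun z hz hz' ↦ ?_⟩
  · exact hord z 1 (by simp [hz, hdisj hz])
  · exact hord z (-1) (by simp [hz, mt hdisj (not_not.2 hz)])
  · exact hord z 0 (by simp [hz, hz'])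

lemma notMem_lattice_of_order_nonpos (hf : IsEllipticOfLevel L N f) {z : ℂ}
    (hz : meromorphicOrderAt f z ≤ 0) : z ∉ L.lattice := by
  obtain ⟨ρ, -, h, -⟩ := hf.exists_order
  intro hzL
  rw [h z hzL] at hz
  exact absurd hz (by decide)

/-- As `f ^ N` is periodic, `f (z + l) / f z` is an `N`-th root of unity; it depends continuously on
`z` off the zeros and poles of `f`, which form a set with connected complement. -/
lemma exists_map_add (hf : IsEllipticOfLevel L N f) {l : ℂ} (hl : l ∈ L.lattice) :
    ∃ c : ℂ, c ^ N = 1 ∧ ∀ z, f (z + l) = c * f z := by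
  obtain ⟨ρ, hρ, hzero, hpole, hreg⟩ := hf.exists_order
  have hnf (z : ℂ) : MeromorphicNFAt f z := hf.meromorphic (Set.mem_univ z)
  obtain ⟨Z, hZ⟩ : ∃ Z : Set ℂ, Z = {z | z ∈ L.lattice ∨ z - ρ ∈ L.lattice} := ⟨_, rfl⟩
  have hZc : Z.Countable := by
    have h : {z | z - ρ ∈ L.lattice}.Countable :=
      L.countable_lattice.preimage (sub_left_injective (b := ρ))
    rw [hZ]
    exact L.countable_lattice.union h
  have hZadd (z : ℂ) : z + l ∈ Z ↔ z ∈ Z := by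
    have h1 : z + l ∈ L.lattice ↔ z ∈ L.lattice := add_mem_cancel_right hl
    have h2 : z + l - ρ ∈ L.lattice ↔ z - ρ ∈ L.lattice := by
      rw [add_sub_right_comm]
      exact add_mem_cancel_right hl
    simp [hZ, h1, h2]
  have hfZ (z : ℂ) : z ∈ Z ↔ f z = 0 := by
    rw [← not_iff_not, ← ne_eq (f z), ← (hnf z).meromorphicOrderAt_eq_zero_iff, hZ]
    constructor
    · intro h
      exact hreg z (fun h' ↦ h (.inl h')) (fun h' ↦ h (.inr h'))
    · rintro h (h' | h')
      · simp [hzero z h'] at h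
      · rw [hpole z h'] at h
        exact absurd h (by decide)
  have hcont {z : ℂ} (hz : z ∉ Z) : ContinuousAt f z :=
    ((hnf z).meromorphicOrderAt_nonneg_iff_analyticAt.1
      ((hnf z).meromorphicOrderAt_eq_zero_iff.2 (mt (hfZ z).2 hz)).ge).continuousAt
  have hconn := Complex.isConnected_compl_of_countable hZc
  obtain ⟨z₀, hz₀⟩ := hconn.nonempty
  have hroots : {x : ℂ | x ^ N = 1}.Finite := by
    refine (Polynomial.nthRoots N (1 : ℂ)).toFinset.finite_toSet.subset fun x hx ↦ ?_
    simpa [Polynomial.mem_nthRoots hf.pos] using hx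
  have hmaps : Set.MapsTo (fun z ↦ f (z + l) / f z) Zᶜ {x : ℂ | x ^ N = 1} := by
    intro z hz
    have h : f (z + l) ^ N = f z ^ N := hf.isLeast.1.2.1.2 l hl z
    simp only [Set.mem_ofPred_eq]
    rw [div_pow, h, div_self (pow_ne_zero N (mt (hfZ z).2 hz))]
  have hq : ContinuousOn (fun z ↦ f (z + l) / f z) Zᶜ := fun z hz ↦
    (((hcont (mt (hZadd z).1 hz)).comp' (f := fun z ↦ z + l) (by fun_prop)).div (hcont hz)
      (mt (hfZ z).2 hz)).continuousWithinAt
  refine ⟨f (z₀ + l) / f z₀, hmaps hz₀, fun z ↦ ?_⟩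
  by_cases hz : z ∈ Z
  · rw [(hfZ z).1 hz, (hfZ _).1 ((hZadd z).2 hz), mul_zero]
  · rw [← hconn.isPreconnected.constant_of_mapsTo hroots.isDiscrete hq hmaps hz hz₀,
      div_mul_cancel₀ _ (mt (hfZ z).2 hz)]

/-- The reciprocal of an elliptic function of level `N` has a multiplier with values in the `N`-th
roots of unity and a single simple pole modulo the lattice. -/
theorem exists_hasMultiplierAndSimplePoles (hf : IsEllipticOfLevel L N f) :
    ∃ χ : ℂ → ℂ, (∀ l ∈ L.lattice, χ l ^ N = 1) ∧ L.HasMultiplierAndSimplePoles χ f⁻¹ := by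
  have hmul : ∀ l ∈ L.lattice, ∃ c : ℂ, c ^ N = 1 ∧ ∀ z, f⁻¹ (z + l) = c * f⁻¹ z := by
    intro l hl
    obtain ⟨c, hc, h⟩ := hf.exists_map_add hl
    exact ⟨c⁻¹, by rw [inv_pow, hc, inv_one], fun z ↦ by simp [h, mul_comm]⟩
  choose! χ hχ using hmul
  refine ⟨χ, fun l hl ↦ (hχ l hl).1, fun z _ ↦ (hf.meromorphicAt z).inv, fun z hz ↦ ?_,
    fun l hl ↦ (hχ l hl).2, ?_⟩
  · refine (hf.meromorphic (Set.mem_univ z)).inv.meromorphicOrderAt_nonneg_iff_analyticAt.1 ?_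
    rw [meromorphicOrderAt_inv]
    obtain ⟨ρ, -, -, hpole, hreg⟩ := hf.exists_order
    by_cases hz' : z - ρ ∈ L.lattice
    · rw [hpole z hz']
      decide
    · simp [hreg z hz hz']
  · have h := (hasDerivAt_iff_tendsto_slope.1 hf.hasDerivAt_zero).inv₀ one_ne_zero
    rw [inv_one] at h
    refine h.congr fun z ↦ ?_
    simp [slope_def_field, hf.map_zero, div_eq_mul_inv]

end IsEllipticOfLevel

theorem mainTheorem9 (L : PeriodPair) (N : ℕ) (f : ℂ → ℂ) (hf : IsEllipticOfLevel L N f)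
    (n : ℕ) (hn : 1 < n) (hNn : N ∣ n) :
    IsHirzebruchSolution n 0 f := by
  refine ⟨hf.meromorphic, hf.map_zero, hf.hasDerivAt_zero, fun z hz ↦ ?_⟩
  obtain ⟨χ, hχ, hg⟩ := hf.exists_hasMultiplierAndSimplePoles
  have hz' (i j : Fin n) (hij : i ≠ j) : z j - z i ∉ L.lattice :=
    hf.notMem_lattice_of_order_nonpos (hz i j hij)
  have hcard (k : Fin n) : (Finset.univ.erase k).card + 1 = n := by
    rw [Finset.card_erase_add_one (Finset.mem_univ k), Finset.card_univ, Fintype.card_fin]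
  have h := sum_prod_erase_eq_hirzebruchSum f⁻¹ z (⟨0, by omega⟩ : Fin n)
  rw [hg.hirzebruchSum_eq_zero] at h
  · simpa [one_div] using h
  · intro l hl
    obtain ⟨m, rfl⟩ := hNn
    rw [hcard, pow_mul, hχ l hl, one_pow]
  · exact fun i _ j _ hij ↦ hz' i j hij
  · exact fun j hj ↦ hz' j _ (Finset.ne_of_mem_erase hj)
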